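/- All spaces are over $\mathbb{C}$. For a topological vector space $X$, let $X^\star$ be the space of continuous linear functionals with the topology of uniform convergence on totally bounded subsets of $X$; $X$ is *stereotype* if the canonical map $X\to X^{\star\star}$ is an isomorphism of topological vector spaces. A *stereotype algebra* is a unital associative algebra $A$ whose underlying space is stereotype and whose multiplication satisfies: for every totally bounded $S\subseteq A$ and every neighbourhood of zero $U$ there is a neighbourhood of zero $V$ with $S\cdot V\subseteq U$ and $V\cdot S\subseteq U$; it is *involutive* if it carries a continuous involution. A *(left) stereotype module* over $A$ is a left $A$-module $X$ that is a stereotype space and whose action $A\times X\to X$ is continuous in the same sense (in both arguments). The *pseudocompletion* $E^{\triangledown}$ of a locally convex space $E$ is the least linear subspace of the completion of $E$ that contains $E$ and in which every totally bounded Cauchy net converges. $\mathrm{Spec}(A)$ is the set of continuous involutive unital homomorphisms $t:A\to\mathbb{C}$ with the topology of uniform convergence on totally bounded subsets of $A$, and $I_t=\ker t$. A *locally convex bundle* with a system of seminorms $\mathcal P$ over a topological space $M$ is a bundle of vector spaces $\pi:\Xi\to M$ over $\mathbb{C}$, together with a topology on $\Xi$ and a set $\mathcal P$ of functions $p:\Xi\to[0,\infty)$,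 such that $\pi$ is continuous, open and surjective; the restrictions of the $p\in\mathcal P$ to each fibre are seminorms that define a Hausdorff locally convex topology, equal to the one induced from $\Xi$; fibrewise scalar multiplication $\mathbb{C}\times\Xi\to\Xi$ and addition $\Xi\times_M\Xi\to\Xi$ are continuous; each $p\in\mathcal P$ is upper semicontinuous on $\Xi$; and for each $t\in M$ every neighbourhood of $0_t$ in $\Xi$ contains a set $\{\xi:\pi(\xi)\in U,\ p(\xi)<\varepsilon\}$ with $p\in\mathcal P$, $\varepsilon>0$, $U\ni t$ open in $M$. $\mathrm{Sec}(\pi)$ is the $C(M)$-module of continuous sections, with the topology of uniform convergence on compact sets, i.e. given by the seminorms $s\mapsto\sup_{t\in T}p(s(t))$, $p\in\mathcal P$, $T\subseteq M$ compact. **Theorem.** Let $X$ be a stereotype module over an involutive stereotype algebra $A$ and $n\in\mathbb{Z}_{\ge 0}$. For $t\in\mathrm{Spec}(A)$ put $$J^n_t(X)=\big(X/\overline{I_t^{\,n+1}\cdot X}\big)^{\triangledown},\qquad J^n_A(X)=\bigsqcup_{t\in\mathrm{Spec}(A)}J^n_t(X),$$ where $I_t^{\,n+1}$ is the span of products of $n+1$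 elements of $I_t$ and $I_t^{\,n+1}\cdot X$ is the set of finite sums of elements $a\cdot x$, $a\in I_t^{\,n+1}$, $x\in X$. Let $\pi^n:J^n_A(X)\to\mathrm{Spec}(A)$ be the projection, let $j^n(x)(t)=x+\overline{I_t^{\,n+1}\cdot X}$ for $x\in X$, and for a continuous seminorm $p$ on $X$ let $p^n$ be the function on $J^n_A(X)$ whose restriction $p^n_t$ to $J^n_t(X)$ is the continuous extension of the quotient seminorm $p^n_t(x+\overline{I_t^{\,n+1}\cdot X})=\inf\{p(x+y): y\in\overline{I_t^{\,n+1}\cdot X}\}$. Then there is exactly one topology on $J^n_A(X)$ that makes $\pi^n$ a locally convex bundle with the system of seminorms $\{p^n\}$ ($p$ ranging over all continuous seminorms on $X$) and all sections $j^n(x)$, $x\in X$, continuous. For this topology the map $x\mapsto j^n(x)$ is continuous from $X$ to $\mathrm{Sec}(\pi^n)$; $\mathrm{Sec}(\pi^n)$, with $A$ acting by $(a\cdot s)(t)=t(a)\,s(t)$, is an $A$-module with jointly continuous action; and the sets $$W(x,U,p,\varepsilon)=\big\{\xi\in J^n_A(X):\ \pi^n(\xi)\in U,\ p^n_{\pi^n(\xi)}\big(\xi-j^n(x)(\pi^n(\xi))\big)<\varepsilon\big\},$$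 with $x\in X$, $U\subseteq\mathrm{Spec}(A)$ open, $p$ a continuous seminorm on $X$ and $\varepsilon>0$, form a base of the topology. -/

import Mathlib

open Topology Filter TopologicalSpace

noncomputable section

/-! ### Stereotype spaces -/

section Stereotype

variable (X : Type*) [AddCommGroup X] [Module ℂ X] [UniformSpace X]

/-- The stereotype dual `X⋆`: all continuous linear functionals on `X`, with the topology of
uniform convergence on totally bounded subsets of `X`. -/
abbrev StereotypeDual : Type _ :=
  UniformConvergenceCLM (RingHom.id ℂ) ℂ {S : Set X | TotallyBounded S}

variable {X} in
/-- Evaluation at a point is continuous on the stereotype dual. -/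
theorem StereotypeDual.continuous_eval (x : X) :
    Continuous fun f : StereotypeDual X => f x := by
  have : ContinuousEvalConst (StereotypeDual X) X ℂ :=
    UniformConvergenceCLM.continuousEvalConst (RingHom.id ℂ) ℂ _ (by
      refine Set.eq_univ_of_forall fun y => Set.mem_sUnion.2 ⟨{y}, ?_, rfl⟩
      exact Set.finite_singleton y |>.totallyBounded)
  exact continuous_eval_const x

variable {X} in
/-- The canonical map `X → X⋆⋆`, `x ↦ (f ↦ f x)`. -/
def stereotypeBidualMap (x : X) : StereotypeDual (StereotypeDual X) :=
  ({ toFun := fun f => f x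
     map_add' := fun _ _ => rfl
     map_smul' := fun _ _ => rfl
     cont := StereotypeDual.continuous_eval x } : StereotypeDual X →L[ℂ] ℂ)

/-- A topological vector space over `ℂ` is stereotype if the canonical map `X → X⋆⋆` is an
isomorphism of topological vector spaces (the map is linear, so it has to be a homeomorphism;
since `X⋆⋆` is Hausdorff and locally convex, so is then `X`). -/
def IsStereotype : Prop :=
  IsHomeomorph (stereotypeBidualMap : X → StereotypeDual (StereotypeDual X))

end Stereotype

/-- A bilinear operation `A × X → Y` is continuous in the sense of stereotype theory: for every
totally bounded set of one argument and every neighbourhood of zero `U` in the target there is a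
neighbourhood of zero of the other argument such that the products land in `U`. -/
def StereotypeContinuous₂ {A X Y : Type*} [Zero A] [UniformSpace A] [Zero X] [UniformSpace X]
    [Zero Y] [TopologicalSpace Y] (m : A → X → Y) : Prop :=
  (∀ S : Set A, TotallyBounded S → ∀ U ∈ 𝓝 (0 : Y), ∃ V ∈ 𝓝 (0 : X),
      ∀ a ∈ S, ∀ x ∈ V, m a x ∈ U) ∧
  (∀ S : Set X, TotallyBounded S → ∀ U ∈ 𝓝 (0 : Y), ∃ V ∈ 𝓝 (0 : A),
      ∀ a ∈ V, ∀ x ∈ S, m a x ∈ U)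

/-- A (unital, associative) algebra over `ℂ` that is a stereotype space with a multiplication
continuous in the stereotype sense. -/
structure IsStereotypeAlgebra (A : Type*) [Ring A] [Algebra ℂ A] [UniformSpace A]
    [IsUniformAddGroup A] [ContinuousSMul ℂ A] : Prop where
  stereotype : IsStereotype A
  mul : StereotypeContinuous₂ fun a b : A => a * b

/-- A left `A`-module that is a stereotype space with an action of `A` continuous in the
stereotype sense. -/
structure IsStereotypeModule (A X : Type*) [Ring A] [UniformSpace A]
    [AddCommGroup X] [Module ℂ X] [Module A X] [UniformSpace X]
    [IsUniformAddGroup X] [ContinuousSMul ℂ X] : Prop where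
  stereotype : IsStereotype X
  smul : StereotypeContinuous₂ fun (a : A) (x : X) => a • x

/-! ### Pseudocompletion -/

/-- A uniform space is pseudocomplete if every totally bounded Cauchy net (here: Cauchy filter
containing a totally bounded set) converges. -/
def IsPseudocomplete (E : Type*) [UniformSpace E] : Prop :=
  ∀ f : Filter E, Cauchy f → (∃ S ∈ f, TotallyBounded S) → ∃ x, f ≤ 𝓝 x

section Pseudocompletion

variable (E : Type*) [AddCommGroup E] [Module ℂ E] [UniformSpace E] [IsUniformAddGroup E]
  [UniformContinuousConstSMul ℂ E]

/-- The pseudocompletion `E^▽`: the least pseudocomplete vector subspace of the completion of `E`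
that contains `E`. -/
def pseudocompletion : Submodule ℂ (UniformSpace.Completion E) :=
  sInf {S | (∀ x : E, (x : UniformSpace.Completion E) ∈ S) ∧ IsPseudocomplete S}

variable {E} in
theorem coe_mem_pseudocompletion (x : E) :
    (x : UniformSpace.Completion E) ∈ pseudocompletion E :=
  Submodule.mem_sInf.2 fun _ hS => hS.1 x

/-- The canonical map `E → E^▽`. -/
def toPseudocompletion : E →ₗ[ℂ] pseudocompletion E where
  toFun x := ⟨x, coe_mem_pseudocompletion x⟩
  map_add' x y := Subtype.ext (UniformSpace.Completion.coe_add x y)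
  map_smul' c x := Subtype.ext (UniformSpace.Completion.coe_smul c x)

variable {E} in
theorem Seminorm.uniformContinuous_aux (p : Seminorm ℂ E) (hp : Continuous p) :
    UniformContinuous p :=
  Seminorm.uniformContinuous_of_continuousAt_zero hp.continuousAt

variable {E} in
/-- The extension by continuity of a continuous seminorm to the completion. -/
def completionSeminorm (p : Seminorm ℂ E) (hp : Continuous p) :
    Seminorm ℂ (UniformSpace.Completion E) :=
  have hu := p.uniformContinuous_aux hp
  Seminorm.of (UniformSpace.Completion.extension p)
    (fun x y => by
      refine UniformSpace.Completion.induction_on₂ x y ?_ fun a b => ?_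
      · exact isClosed_le
          (UniformSpace.Completion.continuous_extension.comp (continuous_fst.add continuous_snd))
          ((UniformSpace.Completion.continuous_extension.comp continuous_fst).add
            (UniformSpace.Completion.continuous_extension.comp continuous_snd))
      · rw [← UniformSpace.Completion.coe_add, UniformSpace.Completion.extension_coe hu,
          UniformSpace.Completion.extension_coe hu, UniformSpace.Completion.extension_coe hu]
        exact map_add_le_add p a b)
    (fun c x => by
      refine UniformSpace.Completion.induction_on x ?_ fun a => ?_
      · exact isClosed_eq
          (UniformSpace.Completion.continuous_extension.comp (continuous_const_smul c))
          (continuous_const.mul UniformSpace.Completion.continuous_extension)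
      · rw [← UniformSpace.Completion.coe_smul, UniformSpace.Completion.extension_coe hu,
          UniformSpace.Completion.extension_coe hu]
        exact map_smul_eq_mul p c a)

end Pseudocompletion

/-! ### Quotients -/

section Quotient

variable {X : Type*} [AddCommGroup X] [Module ℂ X]

/-- The quotient seminorm `x + N ↦ inf {p (x + y) | y ∈ N}`. -/
def quotientSeminorm (p : Seminorm ℂ X) (N : Submodule ℂ X) : Seminorm ℂ (X ⧸ N) :=
  have hb : ∀ q : X ⧸ N, BddBelow (p '' {x | N.mkQ x = q}) := fun q =>
    ⟨0, by rintro _ ⟨x, -, rfl⟩; exact apply_nonneg p x⟩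
  have hn : ∀ q : X ⧸ N, (p '' {x | N.mkQ x = q}).Nonempty := fun q =>
    (N.mkQ_surjective q).elim fun x hx => ⟨p x, x, hx, rfl⟩
  Seminorm.ofSMulLE (fun q => sInf (p '' {x | N.mkQ x = q}))
    (le_antisymm (csInf_le (hb 0) ⟨0, by simp, by simp⟩)
      (le_csInf (hn 0) (by rintro _ ⟨x, -, rfl⟩; exact apply_nonneg p x)))
    (fun q r => by
      refine le_of_forall_pos_lt_add fun ε hε => ?_
      obtain ⟨_, ⟨x, hx, rfl⟩, hx'⟩ := Real.lt_sInf_add_pos (hn q) (half_pos hε)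
      obtain ⟨_, ⟨y, hy, rfl⟩, hy'⟩ := Real.lt_sInf_add_pos (hn r) (half_pos hε)
      have h1 : sInf (p '' {x | N.mkQ x = q + r}) ≤ p (x + y) :=
        csInf_le (hb _) ⟨x + y, by
          have hx1 : N.mkQ x = q := hx
          have hy1 : N.mkQ y = r := hy
          show N.mkQ (x + y) = q + r
          rw [map_add, hx1, hy1], rfl⟩
      have h2 := map_add_le_add p x y
      linarith)
    (fun c q => by
      refine le_of_forall_pos_lt_add fun ε hε => ?_
      have hc : 0 < ‖c‖ + 1 := by positivity
      obtain ⟨_, ⟨x, hx, rfl⟩, hx'⟩ := Real.lt_sInf_add_pos (hn q) (div_pos hε hc)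
      have hx1 : N.mkQ x = q := hx
      have h1 : sInf (p '' {x | N.mkQ x = c • q}) ≤ p (c • x) :=
        csInf_le (hb _) ⟨c • x, by
          show N.mkQ (c • x) = c • q
          rw [map_smul, hx1], rfl⟩
      rw [map_smul_eq_mul] at h1
      have h2 : ‖c‖ * p x ≤ ‖c‖ * (sInf (p '' {x | N.mkQ x = q}) + ε / (‖c‖ + 1)) :=
        mul_le_mul_of_nonneg_left hx'.le (norm_nonneg c)
      have h3 : ‖c‖ * (ε / (‖c‖ + 1)) < ε := by
        rw [← mul_div_assoc, div_lt_iff₀ hc]; nlinarith [norm_nonneg c]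
      linarith [mul_add ‖c‖ (sInf (p '' {x | N.mkQ x = q})) (ε / (‖c‖ + 1))])

theorem quotientSeminorm_mk (p : Seminorm ℂ X) (N : Submodule ℂ X) (x : X) :
    quotientSeminorm p N (N.mkQ x) = ⨅ y : N, p (x + y) := by
  have : p '' {z | N.mkQ z = N.mkQ x} = Set.range fun y : N => p (x + y) := by
    ext r
    constructor
    · rintro ⟨z, hz, rfl⟩
      have : z - x ∈ N := (Submodule.Quotient.eq N).1 hz
      exact ⟨⟨z - x, this⟩, by simp⟩
    · rintro ⟨y, rfl⟩
      exact ⟨x + y, by simp, rfl⟩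
  exact congrArg sInf this

variable [UniformSpace X] [IsUniformAddGroup X] [ContinuousSMul ℂ X]

theorem continuous_quotientSeminorm (p : Seminorm ℂ X) (hp : Continuous p)
    (N : Submodule ℂ X) : Continuous (quotientSeminorm p N) := by
  have h : ((quotientSeminorm p N).comp N.mkQ) ≤ p := fun x => by
    show quotientSeminorm p N (N.mkQ x) ≤ p x
    rw [quotientSeminorm_mk]
    refine (ciInf_le ⟨0, ?_⟩ (0 : N)).trans (by simp)
    rintro _ ⟨y, rfl⟩
    exact apply_nonneg p _
  have h2 : Continuous ((quotientSeminorm p N).comp N.mkQ) := Seminorm.continuous_of_le hp h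
  exact (Submodule.isQuotientMap_mkQ N).continuous_iff.2 h2

/-- The uniform structure of the quotient topological vector space `X ⧸ N`. -/
instance quotientUniformSpace (N : Submodule ℂ X) : UniformSpace (X ⧸ N) :=
  IsTopologicalAddGroup.rightUniformSpace (X ⧸ N)

instance quotientIsUniformAddGroup (N : Submodule ℂ X) : IsUniformAddGroup (X ⧸ N) :=
  isUniformAddGroup_of_addCommGroup

instance quotientUniformContinuousConstSMul (N : Submodule ℂ X) :
    UniformContinuousConstSMul ℂ (X ⧸ N) :=
  uniformContinuousConstSMul_of_continuousConstSMul ℂ (X ⧸ N)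

end Quotient

/-! ### Locally convex bundles

A bundle of vector spaces over `M` is given by its fibres `E t`, `t : M`; its total space is
`Σ t, E t` and its projection is `Sigma.fst`.  A set of functions on the total space whose
restrictions to the fibres are seminorms is given as a family `P : ι → ∀ t, Seminorm ℂ (E t)`. -/

section Bundles

variable {M : Type*} [TopologicalSpace M] {E : M → Type*} [∀ t, AddCommGroup (E t)]
  [∀ t, Module ℂ (E t)] {ι : Type*}

/-- `τ` makes the projection `Σ t, E t → M` a locally convex bundle with the system of
seminorms `P`. -/
structure IsLocallyConvexBundle (P : ι → ∀ t, Seminorm ℂ (E t))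
    (τ : TopologicalSpace (Σ t, E t)) : Prop where
  continuous_proj : Continuous (fun ξ : Σ t, E t => ξ.1)
  isOpenMap_proj : IsOpenMap (fun ξ : Σ t, E t => ξ.1)
  /-- the seminorms separate the points of each fibre -/
  separating : ∀ t (v : E t), (∀ i, P i t v = 0) → v = 0
  /-- the topology that the seminorms define on a fibre is the one induced by `τ` -/
  fibre_topology : ∀ t, TopologicalSpace.induced (fun v : E t => (⟨t, v⟩ : Σ t, E t)) τ =
    ⨅ i, (P i t).toSeminormedAddCommGroup.toUniformSpace.toTopologicalSpace
  continuous_smul :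
    Continuous fun z : ℂ × (Σ t, E t) => (⟨z.2.1, z.1 • z.2.2⟩ : Σ t, E t)
  /-- continuity of the fibrewise addition; the fibre product of `Σ t, E t` with itself over `M`
  is `Σ t, E t × E t` with the topology induced from the product -/
  continuous_add :
    Continuous[TopologicalSpace.induced
      (fun z : Σ t, E t × E t => ((⟨z.1, z.2.1⟩, ⟨z.1, z.2.2⟩) : (Σ t, E t) × (Σ t, E t)))
      inferInstance, τ] fun z => (⟨z.1, z.2.1 + z.2.2⟩ : Σ t, E t)
  upperSemicontinuous : ∀ i, UpperSemicontinuous fun ξ : Σ t, E t => P i ξ.1 ξ.2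
  nhds_zero : ∀ t, ∀ V ∈ 𝓝 (⟨t, 0⟩ : Σ t, E t), ∃ i, ∃ ε : ℝ, 0 < ε ∧
    ∃ U : Set M, IsOpen U ∧ t ∈ U ∧ {ξ : Σ t, E t | ξ.1 ∈ U ∧ P i ξ.1 ξ.2 < ε} ⊆ V

variable {P : ι → ∀ t, Seminorm ℂ (E t)} {τ : TopologicalSpace (Σ t, E t)}

theorem IsLocallyConvexBundle.continuous_smul_section (h : IsLocallyConvexBundle P τ)
    {s : ∀ t, E t} (hs : Continuous fun t => (⟨t, s t⟩ : Σ t, E t)) (f : C(M, ℂ)) :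
    Continuous fun t => (⟨t, f t • s t⟩ : Σ t, E t) :=
  h.continuous_smul.comp (f.continuous.prodMk hs)

theorem IsLocallyConvexBundle.continuous_add_section (h : IsLocallyConvexBundle P τ)
    {s r : ∀ t, E t} (hs : Continuous fun t => (⟨t, s t⟩ : Σ t, E t))
    (hr : Continuous fun t => (⟨t, r t⟩ : Σ t, E t)) :
    Continuous fun t => (⟨t, s t + r t⟩ : Σ t, E t) := by
  let _ : TopologicalSpace (Σ t, E t × E t) := TopologicalSpace.induced
      (fun z : Σ t, E t × E t => ((⟨z.1, z.2.1⟩, ⟨z.1, z.2.2⟩) : (Σ t, E t) × (Σ t, E t)))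
      inferInstance
  have h1 : Continuous fun t => (⟨t, s t, r t⟩ : Σ t, E t × E t) :=
    continuous_induced_rng.2 (hs.prodMk hr)
  exact Continuous.comp (g := fun z : Σ t, E t × E t => (⟨z.1, z.2.1 + z.2.2⟩ : Σ t, E t))
    h.continuous_add h1

theorem IsLocallyConvexBundle.continuous_zero_section (h : IsLocallyConvexBundle P τ) :
    Continuous fun t => (⟨t, 0⟩ : Σ t, E t) := by
  rw [continuous_iff_continuousAt]
  intro t V hV
  obtain ⟨i, ε, hε, U, hU, htU, hUV⟩ := h.nhds_zero t V hV
  refine mem_map.2 (mem_of_superset (hU.mem_nhds htU) fun s hs => hUV ⟨hs, ?_⟩)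
  simpa using hε

/-- The space `Sec(π)` of continuous sections of a locally convex bundle. -/
def IsLocallyConvexBundle.Sec (h : IsLocallyConvexBundle P τ) : Submodule ℂ (∀ t, E t) where
  carrier := {s | Continuous fun t => (⟨t, s t⟩ : Σ t, E t)}
  add_mem' hs hr := h.continuous_add_section hs hr
  zero_mem' := h.continuous_zero_section
  smul_mem' c _ hs := h.continuous_smul_section hs (ContinuousMap.const M c)

/-- `Sec(π)` is a module over `C(M)` with pointwise multiplication. -/
instance IsLocallyConvexBundle.secModule (h : IsLocallyConvexBundle P τ) :
    Module C(M, ℂ) h.Sec where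
  smul f s := ⟨fun t => f t • s.1 t, h.continuous_smul_section s.2 f⟩
  one_smul s := Subtype.ext (funext fun t => one_smul ℂ (s.1 t))
  mul_smul f g s := Subtype.ext (funext fun t => mul_smul (f t) (g t) (s.1 t))
  smul_zero f := Subtype.ext (funext fun t => smul_zero (f t))
  smul_add f s r := Subtype.ext (funext fun t => smul_add (f t) (s.1 t) (r.1 t))
  add_smul f g s := Subtype.ext (funext fun t => add_smul (f t) (g t) (s.1 t))
  zero_smul s := Subtype.ext (funext fun t => zero_smul ℂ (s.1 t))

theorem IsLocallyConvexBundle.bddAbove_sec (h : IsLocallyConvexBundle P τ) (i : ι)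
    (T : Compacts M) (s : h.Sec) :
    BddAbove (Set.range fun t : T => P i t (s.1 t)) := by
  have hu : UpperSemicontinuous fun t : M => P i t (s.1 t) :=
    (h.upperSemicontinuous i).comp s.2
  have := (hu.upperSemicontinuousOn (T : Set M)).bddAbove_of_isCompact T.isCompact
  refine this.mono ?_
  rintro _ ⟨t, rfl⟩
  exact ⟨t, t.2, rfl⟩

/-- The seminorm `s ↦ sup {p (s t) | t ∈ T}` on `Sec(π)`, for a compact set `T` in the base. -/
def IsLocallyConvexBundle.secSeminorm (h : IsLocallyConvexBundle P τ) (i : ι)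
    (T : Compacts M) : Seminorm ℂ h.Sec :=
  Seminorm.of (fun s => ⨆ t : T, P i t (s.1 t))
    (fun s r => by
      refine Real.iSup_le (fun t => ?_) (add_nonneg
        (Real.iSup_nonneg fun _ => apply_nonneg _ _) (Real.iSup_nonneg fun _ => apply_nonneg _ _))
      exact (map_add_le_add (P i t) (s.1 t) (r.1 t)).trans
        (add_le_add (le_ciSup (h.bddAbove_sec i T s) t) (le_ciSup (h.bddAbove_sec i T r) t)))
    (fun c s => by
      rw [Real.mul_iSup_of_nonneg (norm_nonneg c)]
      exact iSup_congr fun t => map_smul_eq_mul (P i t) c (s.1 t))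

/-- The topology of `Sec(π)`: uniform convergence on compact sets of the base, that is, the
topology defined by the seminorms `secSeminorm`. -/
instance IsLocallyConvexBundle.secTopologicalSpace (h : IsLocallyConvexBundle P τ) :
    TopologicalSpace h.Sec :=
  ⨅ (i : ι) (T : Compacts M),
    (h.secSeminorm i T).toSeminormedAddCommGroup.toUniformSpace.toTopologicalSpace

end Bundles

/-! ### The involutive spectrum and the jet spaces -/

section Spectrum

variable (A : Type*) [Ring A] [Algebra ℂ A] [UniformSpace A] [IsUniformAddGroup A]
  [ContinuousSMul ℂ A] [StarRing A]

/-- The involutive spectrum `Spec(A)`: continuous unital involutive homomorphisms `A → ℂ`, with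
the topology of uniform convergence on totally bounded sets. -/
def InvolutiveSpectrum : Type _ :=
  {t : StereotypeDual A // t 1 = 1 ∧ (∀ a b, t (a * b) = t a * t b) ∧
    ∀ a, t (star a) = star (t a)}

instance : TopologicalSpace (InvolutiveSpectrum A) :=
  inferInstanceAs (TopologicalSpace {t : StereotypeDual A // _})

variable {A}

/-- The ideal `I_t = {a | t a = 0}` as a linear subspace of `A`. -/
def InvolutiveSpectrum.ideal (t : InvolutiveSpectrum A) : Submodule ℂ A where
  carrier := {a | t.1 a = 0}
  add_mem' {a b} ha hb := by
    show t.1 (a + b) = 0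
    rw [map_add, show t.1 a = 0 from ha, show t.1 b = 0 from hb, add_zero]
  zero_mem' := map_zero t.1
  smul_mem' c a ha := by
    show t.1 (c • a) = 0
    rw [map_smul, show t.1 a = 0 from ha, smul_zero]

variable (A) in
/-- The homomorphism `σ : A → C(Spec(A))`, `σ(a)(t) = t(a)`. -/
def spectrumHom : A →ₐ[ℂ] C(InvolutiveSpectrum A, ℂ) where
  toFun a := ⟨fun t => t.1 a, (StereotypeDual.continuous_eval a).comp continuous_subtype_val⟩
  map_one' := ContinuousMap.ext fun t => t.2.1
  map_mul' a b := ContinuousMap.ext fun t => t.2.2.1 a b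
  map_zero' := ContinuousMap.ext fun t => map_zero t.1
  map_add' a b := ContinuousMap.ext fun t => map_add t.1 a b
  commutes' c := ContinuousMap.ext fun t => by
    show t.1 (algebraMap ℂ A c) = c
    rw [Algebra.algebraMap_eq_smul_one, map_smul, t.2.1]
    simp

end Spectrum

section Jets

variable {A : Type*} [Ring A] [Algebra ℂ A] [UniformSpace A] [IsUniformAddGroup A]
  [ContinuousSMul ℂ A] [StarRing A]
variable (X : Type*) [AddCommGroup X] [Module ℂ X] [Module A X] [UniformSpace X]
  [IsUniformAddGroup X] [ContinuousSMul ℂ X]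

/-- The closed subspace `closure (I_t^{n+1}·X)` of `X`.  Here `I_t^{n+1}` is the span of the
products of `n + 1` elements of `I_t` (power of a linear subspace of an algebra), and
`I_t^{n+1}·X` is the set of finite sums of elements `a • x`, `a ∈ I_t^{n+1}`, `x ∈ X`. -/
def jetSubmodule (n : ℕ) (t : InvolutiveSpectrum A) : Submodule ℂ X :=
  (Submodule.span ℂ {y | ∃ a ∈ t.ideal ^ (n + 1), ∃ x : X, a • x = y}).topologicalClosure

/-- The jet space `J^n_t(X) = (X / closure (I_t^{n+1}·X))^▽`. -/
def Jet (n : ℕ) (t : InvolutiveSpectrum A) : Type _ :=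
  pseudocompletion (X ⧸ jetSubmodule X n t)

instance (n : ℕ) (t : InvolutiveSpectrum A) : AddCommGroup (Jet X n t) :=
  inferInstanceAs (AddCommGroup (pseudocompletion (X ⧸ jetSubmodule X n t)))

instance (n : ℕ) (t : InvolutiveSpectrum A) : Module ℂ (Jet X n t) :=
  inferInstanceAs (Module ℂ (pseudocompletion (X ⧸ jetSubmodule X n t)))

/-- The seminorm `p^n_t` on `J^n_t(X)` defined by a continuous seminorm `p` on `X`: the quotient
seminorm, extended by continuity to the pseudocompletion. -/
def jetSeminorm (n : ℕ) (p : {p : Seminorm ℂ X // Continuous p}) (t : InvolutiveSpectrum A) :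
    Seminorm ℂ (Jet X n t) :=
  (completionSeminorm (quotientSeminorm p.1 (jetSubmodule X n t))
    (continuous_quotientSeminorm p.1 p.2 _)).comp
      (pseudocompletion (X ⧸ jetSubmodule X n t)).subtype

variable {X}

/-- The section `j^n(x)`, `j^n(x)(t) = x + closure (I_t^{n+1}·X)`. -/
def jet (n : ℕ) (x : X) (t : InvolutiveSpectrum A) : Jet X n t :=
  toPseudocompletion (X ⧸ jetSubmodule X n t) ((jetSubmodule X n t).mkQ x)

/-- The set `W(x, U, p, ε)` of all `ξ` in the jet bundle with `π(ξ) ∈ U` and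
`p^n_{π(ξ)}(ξ - j^n(x)(π(ξ))) < ε`. -/
def jetBasicSet (n : ℕ) (x : X) (U : Set (InvolutiveSpectrum A))
    (p : {p : Seminorm ℂ X // Continuous p}) (ε : ℝ) :
    Set (Σ t : InvolutiveSpectrum A, Jet X n t) :=
  {ξ | ξ.1 ∈ U ∧ jetSeminorm X n p ξ.1 (ξ.2 - jet n x ξ.1) < ε}

end Jets

end

set_option linter.unusedSectionVars false

/-! The tubes around the sections `j x` are the only possible basis, and whether they form one is a
question about the seminorms alone. `IsGeneratingFamily` isolates what is needed: directed
separating seminorms, dense values of the sections in every fibre, and upper semicontinuity of `t ↦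
P i t (j x t)`. Existence is then a series of ε-estimates: approximate a point by some `j z t`, and
let semicontinuity carry inequalities between sections to nearby fibres. For uniqueness, continuity
of addition and the description of the neighbourhoods of `0_t` make the tubes a basis of any
admissible topology (`eq_generateFrom`).

The algebra enters in the semicontinuity for jets (`upperSemicontinuous_jetSeminorm`). If `p (x + y)
< r` with `y` in `I_t₀^{n+1}·X`, replace each factor `b ∈ I_t₀` of `y` by `b - t(b)·1 ∈ I_t`. This
moves `y` continuously into `I_t^{n+1}·X`, so the inequality persists near `t₀`.

Stereotypy is used twice: continuous seminorms define the topology of `X`, so the `p^n` separate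
points; and a compact subset of `Spec(A)` is an equicontinuous set of functionals, which makes the
action on sections jointly continuous. -/

noncomputable section

/-! ### Bundles generated by a linear space of sections: existence and uniqueness of the topology -/

section Reconstruction

variable {M : Type*} [TopologicalSpace M] {E : M → Type*} [∀ t, AddCommGroup (E t)]
  [∀ t, Module ℂ (E t)] {ι X : Type*} [AddCommGroup X] [Module ℂ X]

/-- A linear space of sections of a family of vector spaces that determines a locally convex
bundle: the seminorms are directed and separate points, they are upper semicontinuous along the
sections, and the values of the sections are dense in each fibre. -/
structure IsGeneratingFamily (P : ι → ∀ t, Seminorm ℂ (E t)) (j : X →ₗ[ℂ] ∀ t, E t) : Prop where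
  nonempty : Nonempty ι
  directed : ∀ i k, ∃ l, ∀ t v, P i t v ≤ P l t v ∧ P k t v ≤ P l t v
  separating : ∀ t (v : E t), (∀ i, P i t v = 0) → v = 0
  upperSemicontinuous : ∀ i x, UpperSemicontinuous fun t => P i t (j x t)
  dense : ∀ i t (v : E t) (ε : ℝ), 0 < ε → ∃ x, P i t (v - j x t) < ε

/-- The set of all points of the total space that lie over `U` and are `ε`-close to the section
`j x` with respect to the seminorm `P i`. -/
def sectionTube (P : ι → ∀ t, Seminorm ℂ (E t)) (j : X →ₗ[ℂ] ∀ t, E t) (x : X) (U : Set M)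
    (i : ι) (ε : ℝ) : Set (Σ t, E t) :=
  {ξ | ξ.1 ∈ U ∧ P i ξ.1 (ξ.2 - j x ξ.1) < ε}

/-- The collection of all tubes around the sections `j x`. -/
def sectionTubes (P : ι → ∀ t, Seminorm ℂ (E t)) (j : X →ₗ[ℂ] ∀ t, E t) :
    Set (Set (Σ t, E t)) :=
  {W | ∃ (x : X) (U : Set M) (i : ι) (ε : ℝ), IsOpen U ∧ 0 < ε ∧ W = sectionTube P j x U i ε}

namespace IsGeneratingFamily

variable {P : ι → ∀ t, Seminorm ℂ (E t)} {j : X →ₗ[ℂ] ∀ t, E t}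

/-- A point common to two tubes need not lie on a section. Density supplies a section `j z` close to
it, and semicontinuity of the seminorms along `z - x` and `z - y` keeps a thin tube around `j z`
inside both tubes over a smaller base. -/
theorem isTopologicalBasis (h : IsGeneratingFamily P j) :
    @IsTopologicalBasis _ (generateFrom (sectionTubes P j)) (sectionTubes P j) := by
  let _ := generateFrom (sectionTubes P j)
  refine ⟨?_, ?_, rfl⟩
  · rintro _ ⟨x, U, i, ε, hU, hε, rfl⟩ _ ⟨y, V, k, δ, hV, hδ, rfl⟩ ⟨t, v⟩ ⟨⟨htU, h1⟩, htV, h2⟩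
    dsimp only at htU h1 htV h2
    obtain ⟨l, hl⟩ := h.directed i k
    -- `η` is the room left in both tubes. Passing from `v` to `j z t` costs less than `η / 2`; the
    -- other half is the radius of the new tube.
    obtain ⟨η, hη, hη'⟩ : ∃ η > 0, η ≤ ε - P i t (v - j x t) ∧ η ≤ δ - P k t (v - j y t) :=
      ⟨min (ε - P i t (v - j x t)) (δ - P k t (v - j y t)), lt_min (by linarith) (by linarith),
        min_le_left _ _, min_le_right _ _⟩
    obtain ⟨z, hz⟩ := h.dense l t v (η / 2) (half_pos hη)
    have key : ∀ (m : ι) (w : X) (r : ℝ), (∀ t v, P m t v ≤ P l t v) →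
        η ≤ r - P m t (v - j w t) → P m t (j (z - w) t) < r - η / 2 := by
      intro m w r hm hr
      have e : j (z - w) t = (v - j w t) - (v - j z t) := by
        rw [map_sub, Pi.sub_apply]; abel
      have := map_sub_le_add (P m t) (v - j w t) (v - j z t)
      rw [← e] at this
      have := hm t (v - j z t)
      linarith
    have o1 := (h.upperSemicontinuous i (z - x)).isOpen_preimage (ε - η / 2)
    have o2 := (h.upperSemicontinuous k (z - y)).isOpen_preimage (δ - η / 2)
    refine ⟨_, ⟨z, _, l, η / 2, (hU.inter hV).inter (o1.inter o2), half_pos hη, rfl⟩,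
      ⟨⟨⟨htU, htV⟩, key i x ε (fun t v => (hl t v).1) hη'.1,
        key k y δ (fun t v => (hl t v).2) hη'.2⟩, hz⟩, ?_⟩
    rintro ⟨s, w⟩ ⟨⟨⟨hsU, hsV⟩, hs1, hs2⟩, hs⟩
    dsimp only at hsU hsV hs
    have hs1 : P i s (j (z - x) s) < ε - η / 2 := hs1
    have hs2 : P k s (j (z - y) s) < δ - η / 2 := hs2
    have fin : ∀ (m : ι) (w' : X) (r : ℝ), (∀ t v, P m t v ≤ P l t v) →
        P m s (j (z - w') s) < r - η / 2 → P m s (w - j w' s) < r := by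
      intro m w' r hm hr
      have e : w - j w' s = (w - j z s) + j (z - w') s := by
        rw [map_sub, Pi.sub_apply]; abel
      have := map_add_le_add (P m s) (w - j z s) (j (z - w') s)
      rw [← e] at this
      have := hm s (w - j z s)
      linarith
    exact ⟨⟨hsU, fin i x ε (fun t v => (hl t v).1) hs1⟩,
      ⟨hsV, fin k y δ (fun t v => (hl t v).2) hs2⟩⟩
  · refine Set.eq_univ_of_forall fun ⟨t, v⟩ => ?_
    obtain ⟨i⟩ := h.nonempty
    obtain ⟨x, hx⟩ := h.dense i t v 1 one_pos
    exact ⟨_, ⟨x, Set.univ, i, 1, isOpen_univ, one_pos, rfl⟩, Set.mem_univ _, hx⟩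

theorem isOpen_sectionTube (P : ι → ∀ t, Seminorm ℂ (E t)) (j : X →ₗ[ℂ] ∀ t, E t) (x : X)
    {U : Set M} (hU : IsOpen U) (i : ι) {ε : ℝ} (hε : 0 < ε) :
    IsOpen[generateFrom (sectionTubes P j)] (sectionTube P j x U i ε) :=
  GenerateOpen.basic _ ⟨x, U, i, ε, hU, hε, rfl⟩

theorem isOpen_setOf_lt (h : IsGeneratingFamily P j) (i : ι) (x : X) (ε : ℝ) :
    IsOpen {t | P i t (j x t) < ε} :=
  (h.upperSemicontinuous i x).isOpen_preimage ε

/-- The preimage of a tube around `j y` is cut out of `U` by `P i t (j (x - y) t) < ε`, an open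
condition by semicontinuity. -/
theorem continuous_section (h : IsGeneratingFamily P j) (x : X) :
    Continuous[_, generateFrom (sectionTubes P j)] fun t => (⟨t, j x t⟩ : Σ t, E t) := by
  let _ := generateFrom (sectionTubes P j)
  refine continuous_generateFrom_iff.2 ?_
  rintro _ ⟨y, U, i, ε, hU, hε, rfl⟩
  convert hU.inter (h.isOpen_setOf_lt i (x - y) ε) using 1
  ext t
  simp [sectionTube]

theorem continuous_proj (h : IsGeneratingFamily P j) :
    Continuous[generateFrom (sectionTubes P j), _] fun ξ : Σ t, E t => ξ.1 := by
  let _ := generateFrom (sectionTubes P j)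
  refine continuous_def.2 fun U hU => isOpen_iff_mem_nhds.2 fun ⟨t, v⟩ ht => ?_
  obtain ⟨i⟩ := h.nonempty
  obtain ⟨x, hx⟩ := h.dense i t v 1 one_pos
  exact mem_of_superset ((isOpen_sectionTube P j x hU i one_pos).mem_nhds ⟨ht, hx⟩)
    fun ξ hξ => hξ.1

theorem isOpenMap_proj (h : IsGeneratingFamily P j) :
    @IsOpenMap _ _ (generateFrom (sectionTubes P j)) _ fun ξ : Σ t, E t => ξ.1 := by
  let _ := generateFrom (sectionTubes P j)
  refine h.isTopologicalBasis.isOpenMap_iff.2 ?_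
  rintro _ ⟨x, U, i, ε, hU, hε, rfl⟩
  convert hU using 1
  refine Set.Subset.antisymm ?_ fun t ht => ⟨⟨t, j x t⟩, ⟨ht, by simpa using hε⟩, rfl⟩
  rintro _ ⟨ξ, hξ, rfl⟩
  exact hξ.1

/-- Tubes meet the fibre in seminorm balls centred at values of sections; by density every ball
around an arbitrary `v` contains such a ball of half the radius around `v`. -/
theorem fibre_topology (h : IsGeneratingFamily P j) (t : M) :
    TopologicalSpace.induced (fun v : E t => (⟨t, v⟩ : Σ t, E t))
        (generateFrom (sectionTubes P j)) =
      ⨅ i, (P i t).toSeminormedAddCommGroup.toUniformSpace.toTopologicalSpace := by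
  have hball : ∀ (i : ι) (w : E t) (r : ℝ),
      @Metric.ball (E t) (P i t).toSeminormedAddCommGroup.toPseudoMetricSpace w r =
        {v | P i t (v - w) < r} := by
    intro i w r
    let _ := (P i t).toSeminormedAddCommGroup
    ext v
    rw [mem_ball_iff_norm]
    rfl
  refine le_antisymm (le_iInf fun i => ?_) ?_
  · refine (@le_iff_nhds _ (_) (_)).2 fun v => ?_
    let _ := (P i t).toSeminormedAddCommGroup
    refine Metric.nhds_basis_ball.ge_iff.2 fun ε hε => ?_
    obtain ⟨x, hx⟩ := h.dense i t v (ε / 2) (half_pos hε)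
    let _ := generateFrom (sectionTubes P j)
    refine (mem_nhds_induced (fun v : E t => (⟨t, v⟩ : Σ t, E t)) v _).2 ⟨_, IsOpen.mem_nhds
      (isOpen_sectionTube P j x isOpen_univ i (half_pos hε)) ⟨Set.mem_univ _, hx⟩, ?_⟩
    rintro w ⟨-, hw⟩
    have hw : P i t (w - j x t) < ε / 2 := hw
    rw [hball]
    have := map_sub_le_add (P i t) (w - j x t) (v - j x t)
    rw [sub_sub_sub_cancel_right] at this
    exact this.trans_lt (by linarith)
  · rw [← continuous_iff_le_induced]
    refine continuous_generateFrom_iff.2 ?_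
    rintro _ ⟨x, U, i, ε, hU, hε, rfl⟩
    refine TopologicalSpace.le_def.1 (iInf_le _ i) _ ?_
    by_cases ht : t ∈ U
    · have : (fun v : E t => (⟨t, v⟩ : Σ t, E t)) ⁻¹' sectionTube P j x U i ε =
          @Metric.ball (E t) (P i t).toSeminormedAddCommGroup.toPseudoMetricSpace (j x t) ε := by
        rw [hball]
        ext v
        simp [sectionTube, ht]
      rw [this]
      let _ := (P i t).toSeminormedAddCommGroup
      exact Metric.isOpen_ball
    · have : (fun v : E t => (⟨t, v⟩ : Σ t, E t)) ⁻¹' sectionTube P j x U i ε = ∅ := by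
        ext v
        simp [sectionTube, ht]
      rw [this]
      exact @isOpen_empty _ (_)

theorem continuous_smul (h : IsGeneratingFamily P j) :
    let _ := generateFrom (sectionTubes P j)
    Continuous fun z : ℂ × (Σ t, E t) => (⟨z.2.1, z.1 • z.2.2⟩ : Σ t, E t) := by
  intro _
  refine continuous_generateFrom_iff.2 ?_
  rintro _ ⟨x, U, i, ε, hU, hε, rfl⟩
  refine isOpen_iff_mem_nhds.2 ?_
  rintro ⟨c, t, v⟩ ⟨ht, hv⟩
  dsimp only at ht hv
  -- `c' • w - j x` is split as `c' • (w - j z) + (c' - c) • j z + j (c • z - x)`. The slack `g` is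
  -- distributed so that these terms are bounded by `g / 4`, `g / 4` and `ε - g / 2`. The bound `K`
  -- exceeds `P i t (j z t)` by 1, so it persists near `t`; `r ≤ 1` gives `‖c'‖ ≤ ‖c‖ + 1`.
  set g := ε - P i t (c • v - j x t) with hg
  have hg0 : 0 < g := by linarith
  have hc : 0 < ‖c‖ + 1 := by positivity
  obtain ⟨z, hz⟩ := h.dense i t v (g / 4 / (‖c‖ + 1)) (by positivity)
  set δ := g / 4 / (‖c‖ + 1) with hδ
  have hδ0 : 0 < δ := by positivity
  have hδc : (‖c‖ + 1) * δ = g / 4 := by rw [hδ]; field_simp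
  have hcx : P i t (j (c • z - x) t) < ε - g / 2 := by
    have e : j (c • z - x) t = (c • v - j x t) - c • (v - j z t) := by
      rw [map_sub, map_smul, Pi.sub_apply, Pi.smul_apply, smul_sub]; abel
    have h1 := map_sub_le_add (P i t) (c • v - j x t) (c • (v - j z t))
    rw [← e, map_smul_eq_mul] at h1
    have h2 : ‖c‖ * P i t (v - j z t) ≤ ‖c‖ * δ :=
      mul_le_mul_of_nonneg_left hz.le (norm_nonneg c)
    nlinarith
  set K := P i t (j z t) + 1 with hK
  have hK0 : 0 < K := by have := apply_nonneg (P i t) (j z t); linarith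
  obtain ⟨r, hr0, hr1, hrK⟩ : ∃ r > 0, r ≤ 1 ∧ r * K ≤ g / 4 :=
    ⟨min 1 (g / 4 / K), by positivity, min_le_left _ _,
      (mul_le_mul_of_nonneg_right (min_le_right _ _) hK0.le).trans_eq (by field_simp)⟩
  have hO := (hU.inter (h.isOpen_setOf_lt i (c • z - x) (ε - g / 2))).inter
    (h.isOpen_setOf_lt i z K)
  refine mem_of_superset (prod_mem_nhds (Metric.ball_mem_nhds c hr0)
    ((isOpen_sectionTube P j z hO i hδ0).mem_nhds ⟨⟨⟨ht, hcx⟩, ?_⟩, hz⟩)) ?_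
  · exact lt_add_one (P i t (j z t))
  rintro ⟨c', s, w⟩ ⟨hc', ⟨⟨hsU, hs1⟩, hs2⟩, hs3⟩
  have hs1 : P i s (j (c • z - x) s) < ε - g / 2 := hs1
  have hs2 : P i s (j z s) < K := hs2
  have hs3 : P i s (w - j z s) < δ := hs3
  refine ⟨hsU, ?_⟩
  show P i s (c' • w - j x s) < ε
  have hc'c : ‖c' - c‖ < r := by simpa [dist_eq_norm] using hc'
  have hc'n : ‖c'‖ ≤ ‖c‖ + 1 := by
    have := norm_le_norm_add_norm_sub' c' c
    linarith
  have e : c' • w - j x s = (c' • (w - j z s) + (c' - c) • j z s) + j (c • z - x) s := by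
    rw [map_sub, map_smul, Pi.sub_apply, Pi.smul_apply, smul_sub, sub_smul]; abel
  rw [e]
  have h1 := map_add_le_add (P i s) (c' • (w - j z s) + (c' - c) • j z s) (j (c • z - x) s)
  have h2 := map_add_le_add (P i s) (c' • (w - j z s)) ((c' - c) • j z s)
  rw [map_smul_eq_mul, map_smul_eq_mul] at h2
  have h3 : ‖c'‖ * P i s (w - j z s) ≤ (‖c‖ + 1) * δ :=
    mul_le_mul hc'n hs3.le (apply_nonneg _ _) hc.le
  have h4 : ‖c' - c‖ * P i s (j z s) ≤ r * K :=
    mul_le_mul hc'c.le hs2.le (apply_nonneg _ _) hr0.le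
  linarith

theorem continuous_add (h : IsGeneratingFamily P j) :
    let τ := generateFrom (sectionTubes P j)
    Continuous[TopologicalSpace.induced
      (fun z : Σ t, E t × E t => ((⟨z.1, z.2.1⟩, ⟨z.1, z.2.2⟩) : (Σ t, E t) × (Σ t, E t)))
      inferInstance, τ] fun z => (⟨z.1, z.2.1 + z.2.2⟩ : Σ t, E t) := by
  intro τ
  let _ : TopologicalSpace (Σ t, E t × E t) := TopologicalSpace.induced
    (fun z : Σ t, E t × E t => ((⟨z.1, z.2.1⟩, ⟨z.1, z.2.2⟩) : (Σ t, E t) × (Σ t, E t)))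
    inferInstance
  refine continuous_generateFrom_iff.2 ?_
  rintro _ ⟨x, U, i, ε, hU, hε, rfl⟩
  refine isOpen_iff_mem_nhds.2 ?_
  rintro ⟨t, v, w⟩ ⟨ht, hv⟩
  dsimp only at ht hv
  -- Approximating `v` and `w` within `g / 4` by `j y` and `j z` leaves `j (y + z - x)` below `ε - g
  -- / 2`; tubes of radius `g / 4` then use up exactly the rest.
  set g := ε - P i t (v + w - j x t) with hg
  have hg0 : 0 < g := by linarith
  obtain ⟨y, hy⟩ := h.dense i t v (g / 4) (by positivity)
  obtain ⟨z, hz⟩ := h.dense i t w (g / 4) (by positivity)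
  have hyz : P i t (j (y + z - x) t) < ε - g / 2 := by
    have e : j (y + z - x) t = (v + w - j x t) - ((v - j y t) + (w - j z t)) := by
      rw [map_sub, map_add, Pi.sub_apply, Pi.add_apply]; abel
    have h1 := map_sub_le_add (P i t) (v + w - j x t) ((v - j y t) + (w - j z t))
    have h2 := map_add_le_add (P i t) (v - j y t) (w - j z t)
    rw [← e] at h1
    linarith
  have hO := hU.inter (h.isOpen_setOf_lt i (y + z - x) (ε - g / 2))
  have hg4 : 0 < g / 4 := by positivity
  refine (mem_nhds_induced _ _ _).2 ⟨_, prod_mem_nhds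
    ((isOpen_sectionTube P j y hO i hg4).mem_nhds ⟨⟨ht, hyz⟩, hy⟩)
    ((isOpen_sectionTube P j z hO i hg4).mem_nhds ⟨⟨ht, hyz⟩, hz⟩), ?_⟩
  rintro ⟨s, v', w'⟩ ⟨⟨⟨hsU, hs1⟩, hs2⟩, -, hs3⟩
  have hs1 : P i s (j (y + z - x) s) < ε - g / 2 := hs1
  have hs2 : P i s (v' - j y s) < g / 4 := hs2
  have hs3 : P i s (w' - j z s) < g / 4 := hs3
  refine ⟨hsU, ?_⟩
  show P i s (v' + w' - j x s) < ε
  have e : v' + w' - j x s = ((v' - j y s) + (w' - j z s)) + j (y + z - x) s := by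
    rw [map_sub, map_add, Pi.sub_apply, Pi.add_apply]; abel
  rw [e]
  have h1 := map_add_le_add (P i s) ((v' - j y s) + (w' - j z s)) (j (y + z - x) s)
  have h2 := map_add_le_add (P i s) (v' - j y s) (w' - j z s)
  linarith

/-- A generating family of sections defines a locally convex bundle. -/
theorem isLocallyConvexBundle (h : IsGeneratingFamily P j) :
    IsLocallyConvexBundle P (generateFrom (sectionTubes P j)) := by
  let _ := generateFrom (sectionTubes P j)
  refine ⟨h.continuous_proj, h.isOpenMap_proj, h.separating, h.fibre_topology,
    h.continuous_smul, h.continuous_add, fun i => ?_, fun t V hV => ?_⟩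
  · refine upperSemicontinuous_iff_isOpen_preimage.2 fun r => ?_
    rcases le_or_gt r 0 with hr | hr
    · convert isOpen_empty
      ext ξ
      simpa using hr.trans (apply_nonneg _ _)
    · convert isOpen_sectionTube P j 0 isOpen_univ i hr using 1
      ext ξ
      simp [sectionTube]
  · obtain ⟨_, ⟨x, U, i, ε, hU, hε, rfl⟩, ⟨ht, hx⟩, hV⟩ :=
      h.isTopologicalBasis.mem_nhds_iff.1 hV
    have hx : P i t (j x t) < ε := by simpa using hx
    -- The tube is centred at `j x`, not at zero. Where `P i s (j x s) < r`, the triangle inequality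
    -- leaves the radius `ε - r` around zero.
    obtain ⟨r, hr, hr'⟩ := exists_between hx
    refine ⟨i, ε - r, by linarith, _, hU.inter (h.isOpen_setOf_lt i x r), ⟨ht, hr⟩, ?_⟩
    rintro ⟨s, v⟩ ⟨⟨hs, hs1⟩, hs2⟩
    refine hV ⟨hs, ?_⟩
    have := map_sub_le_add (P i s) v (j x s)
    have hs1 : P i s (j x s) < r := hs1
    exact this.trans_lt (by linarith)

end IsGeneratingFamily

/-- This is continuity of addition at the pair `(0_t, v)`, with the neighbourhood of `0_t` written
through a seminorm. It replaces translation, which does not act on the total space without a global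
section through `v`. -/
theorem IsLocallyConvexBundle.exists_add_mem {P : ι → ∀ t, Seminorm ℂ (E t)}
    {τ : TopologicalSpace (Σ t, E t)} (h : IsLocallyConvexBundle P τ) {t : M} {v : E t}
    {V : Set (Σ t, E t)} (hV : V ∈ 𝓝 (⟨t, v⟩ : Σ t, E t)) :
    ∃ i, ∃ ε : ℝ, 0 < ε ∧ ∃ U : Set M, IsOpen U ∧ t ∈ U ∧ ∃ V' ∈ 𝓝 (⟨t, v⟩ : Σ t, E t),
      ∀ s ∈ U, ∀ u w : E s, P i s u < ε → (⟨s, w⟩ : Σ t, E t) ∈ V' →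
        (⟨s, u + w⟩ : Σ t, E t) ∈ V := by
  let _ : TopologicalSpace (Σ t, E t × E t) := TopologicalSpace.induced
      (fun z : Σ t, E t × E t => ((⟨z.1, z.2.1⟩, ⟨z.1, z.2.2⟩) : (Σ t, E t) × (Σ t, E t)))
      inferInstance
  have h1 : (fun z : Σ t, E t × E t => (⟨z.1, z.2.1 + z.2.2⟩ : Σ t, E t)) ⁻¹' V ∈
      𝓝 (⟨t, 0, v⟩ : Σ t, E t × E t) :=
    h.continuous_add.continuousAt (by simpa using hV)
  rw [nhds_induced, mem_comap] at h1
  obtain ⟨N, hN, hNV⟩ := h1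
  obtain ⟨V₁, hV₁, V', hV', hVN⟩ := mem_nhds_prod_iff.1 hN
  obtain ⟨i, ε, hε, U, hU, ht, hUV⟩ := h.nhds_zero t V₁ hV₁
  exact ⟨i, ε, hε, U, hU, ht, V', hV', fun s hs u w hu hw =>
    hNV (a := (⟨s, u, w⟩ : Σ t, E t × E t)) (hVN ⟨hUV ⟨hs, hu⟩, hw⟩)⟩

theorem IsGeneratingFamily.exists_sectionTube_subset {P : ι → ∀ t, Seminorm ℂ (E t)}
    {j : X →ₗ[ℂ] ∀ t, E t} (h : IsGeneratingFamily P j) {τ : TopologicalSpace (Σ t, E t)}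
    (hτ : IsLocallyConvexBundle P τ)
    (hj : ∀ x, Continuous fun t => (⟨t, j x t⟩ : Σ t, E t)) {V : Set (Σ t, E t)}
    (hV : IsOpen V) {ξ : Σ t, E t} (hξ : ξ ∈ V) : ∃ W ∈ sectionTubes P j, ξ ∈ W ∧ W ⊆ V := by
  obtain ⟨t, v⟩ := ξ
  obtain ⟨i, ε, hε, U, hU, htU, V', hV', hadd⟩ := hτ.exists_add_mem (hV.mem_nhds hξ)
  -- A second use of addition ensures that a section value close to `v` lies in the interior of
  -- `V'`. Continuity of that section then keeps it there over an open base set.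
  obtain ⟨k, δ, hδ, U₁, -, htU₁, V₁, hV₁, hadd₁⟩ :=
    hτ.exists_add_mem (interior_mem_nhds.2 hV')
  obtain ⟨l, hl⟩ := h.directed i k
  obtain ⟨x, hx⟩ := h.dense l t v (min ε δ) (lt_min hε hδ)
  have hxV' : (⟨t, j x t⟩ : Σ t, E t) ∈ interior V' := by
    have := hadd₁ t htU₁ (j x t - v) v (by
      rw [map_sub_rev]
      exact (hl t _).2.trans_lt (hx.trans_le (min_le_right _ _))) (mem_of_mem_nhds hV₁)
    rwa [sub_add_cancel] at this
  have hO : IsOpen (U ∩ (fun t => (⟨t, j x t⟩ : Σ t, E t)) ⁻¹' interior V') :=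
    hU.inter (isOpen_interior.preimage (hj x))
  refine ⟨_, ⟨x, _, i, ε, hO, hε, rfl⟩,
    ⟨⟨htU, hxV'⟩, (hl t _).1.trans_lt (hx.trans_le (min_le_left _ _))⟩, ?_⟩
  rintro ⟨s, w⟩ ⟨⟨hs, hs'⟩, hw⟩
  have := hadd s hs (w - j x s) (j x s) hw (interior_subset hs')
  rwa [sub_add_cancel] at this

/-- The topology of a locally convex bundle is determined by a generating family of continuous
sections. -/
theorem IsGeneratingFamily.eq_generateFrom {P : ι → ∀ t, Seminorm ℂ (E t)}
    {j : X →ₗ[ℂ] ∀ t, E t} (h : IsGeneratingFamily P j) {τ : TopologicalSpace (Σ t, E t)}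
    (hτ : IsLocallyConvexBundle P τ)
    (hj : ∀ x, Continuous[_, τ] fun t => (⟨t, j x t⟩ : Σ t, E t)) :
    τ = generateFrom (sectionTubes P j) := by
  refine le_antisymm (le_generateFrom ?_) fun V hV => ?_
  · rintro _ ⟨x, U, i, ε, hU, hε, rfl⟩
    let _ : TopologicalSpace (Σ t, E t × E t) := TopologicalSpace.induced
      (fun z : Σ t, E t × E t => ((⟨z.1, z.2.1⟩, ⟨z.1, z.2.2⟩) : (Σ t, E t) × (Σ t, E t)))
      inferInstance
    -- Adding the continuous section `j (-x)` is continuous, and turns the tube around `j x` into an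
    -- open sublevel set of `P i`.
    have h1 : Continuous fun ξ : Σ t, E t => (⟨ξ.1, ξ.2, j (-x) ξ.1⟩ : Σ t, E t × E t) :=
      continuous_induced_rng.2 (continuous_id.prodMk ((hj (-x)).comp hτ.continuous_proj))
    have h2 : Continuous fun ξ : Σ t, E t => (⟨ξ.1, ξ.2 + j (-x) ξ.1⟩ : Σ t, E t) :=
      Continuous.comp (g := fun z : Σ t, E t × E t => (⟨z.1, z.2.1 + z.2.2⟩ : Σ t, E t))
        hτ.continuous_add h1
    have h3 := (((hτ.upperSemicontinuous i).isOpen_preimage ε).preimage h2).inter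
      (hU.preimage hτ.continuous_proj)
    convert h3 using 1
    ext ξ
    simp [sectionTube, and_comm, sub_eq_add_neg]
  · choose W hW hξW hWV using fun ξ : V => h.exists_sectionTube_subset hτ hj hV ξ.2
    rw [show V = ⋃ ξ, W ξ from
      Set.Subset.antisymm (fun ξ hξ => Set.mem_iUnion.2 ⟨⟨ξ, hξ⟩, hξW _⟩) (Set.iUnion_subset hWV)]
    exact @isOpen_iUnion _ _ (_) _ fun ξ => GenerateOpen.basic _ (hW ξ)

end Reconstruction

/-! ### Continuity of maps into the space of sections and of the action on it -/

section Sections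

variable {M : Type*} [TopologicalSpace M] {E : M → Type*} [∀ t, AddCommGroup (E t)]
  [∀ t, Module ℂ (E t)] {ι : Type*} {P : ι → ∀ t, Seminorm ℂ (E t)}
  {τ : TopologicalSpace (Σ t, E t)}

theorem IsLocallyConvexBundle.withSeminorms_sec (h : IsLocallyConvexBundle P τ) :
    WithSeminorms fun k : ι × Compacts M => h.secSeminorm k.1 k.2 := by
  have : IsTopologicalAddGroup h.Sec :=
    topologicalAddGroup_iInf fun i => topologicalAddGroup_iInf fun T =>
      let _ := (h.secSeminorm i T).toSeminormedAddCommGroup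
      inferInstance
  rw [SeminormFamily.withSeminorms_iff_topologicalSpace_eq_iInf, iInf_prod]
  rfl

theorem IsLocallyConvexBundle.le_secSeminorm (h : IsLocallyConvexBundle P τ) (i : ι)
    {T : Compacts M} (s : h.Sec) {t : M} (ht : t ∈ T) : P i t (s.1 t) ≤ h.secSeminorm i T s :=
  le_ciSup (h.bddAbove_sec i T s) ⟨t, ht⟩

theorem IsLocallyConvexBundle.secSeminorm_le (h : IsLocallyConvexBundle P τ) {i : ι}
    {T : Compacts M} {s : h.Sec} {r : ℝ} (hr : 0 ≤ r) (hs : ∀ t ∈ T, P i t (s.1 t) ≤ r) :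
    h.secSeminorm i T s ≤ r :=
  Real.iSup_le (fun t => hs t t.2) hr

/-- A linear map to the space of sections is continuous if it is bounded pointwise by continuous
seminorms. -/
theorem IsLocallyConvexBundle.continuous_of_le (h : IsLocallyConvexBundle P τ) {X : Type*}
    [AddCommGroup X] [Module ℂ X] [TopologicalSpace X] [IsTopologicalAddGroup X]
    [ContinuousConstSMul ℂ X] (f : X →ₗ[ℂ] h.Sec) (p : ι → Seminorm ℂ X)
    (hp : ∀ i, Continuous (p i)) (hf : ∀ i x t, P i t ((f x).1 t) ≤ p i x) : Continuous f :=
  WithSeminorms.continuous_of_continuous_comp h.withSeminorms_sec f fun k =>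
    Seminorm.continuous_of_le (hp k.1) fun x =>
      h.secSeminorm_le (apply_nonneg _ _) fun t _ => hf k.1 x t

/-- The multiplication of sections by functions is jointly continuous along a linear map
`φ : A → C(M)` that is continuous for the topology of uniform convergence on compact sets. -/
theorem IsLocallyConvexBundle.continuous_smul_sec (h : IsLocallyConvexBundle P τ) {A : Type*}
    [AddCommGroup A] [Module ℂ A] [TopologicalSpace A] [IsTopologicalAddGroup A]
    (φ : A →ₗ[ℂ] C(M, ℂ))
    (hφ : ∀ T : Compacts M, ∃ p : Seminorm ℂ A, Continuous p ∧ ∀ t ∈ T, ∀ a, ‖φ a t‖ ≤ p a) :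
    Continuous fun z : A × h.Sec => φ z.1 • z.2 := by
  have hw := h.withSeminorms_sec
  have := hw.topologicalAddGroup
  rw [continuous_iff_continuousAt]
  rintro ⟨a₀, s₀⟩
  refine (hw.tendsto_nhds _ _).2 ?_
  rintro ⟨i, T⟩ ε hε
  obtain ⟨p, hp, hpT⟩ := hφ T
  have hq : Continuous (h.secSeminorm i T) := hw.continuous_seminorm (i, T)
  have hsmul : ∀ a s, h.secSeminorm i T (φ a • s) ≤ p a * h.secSeminorm i T s := fun a s =>
    h.secSeminorm_le (mul_nonneg (apply_nonneg _ _) (apply_nonneg _ _)) fun t ht => by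
      show P i t (φ a t • s.1 t) ≤ _
      rw [map_smul_eq_mul]
      exact mul_le_mul (hpT t ht a) (h.le_secSeminorm i s ht) (apply_nonneg _ _)
        (apply_nonneg _ _)
  -- This continuous function vanishes at `(a₀, s₀)` and dominates the seminorm of `φ a • (s - s₀) +
  -- φ (a - a₀) • s₀`.
  have hc : Continuous fun z : A × h.Sec =>
      p z.1 * h.secSeminorm i T (z.2 - s₀) + p (z.1 - a₀) * h.secSeminorm i T s₀ := by
    fun_prop
  have hlt := (hc.tendsto (a₀, s₀)).eventually_lt_const (u := ε) (by simpa using hε)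
  filter_upwards [hlt] with z hz
  have e : φ z.1 • z.2 - φ a₀ • s₀ = φ z.1 • (z.2 - s₀) + φ (z.1 - a₀) • s₀ := by
    rw [map_sub, smul_sub, sub_smul]; abel
  rw [e]
  exact ((map_add_le_add _ _ _).trans (add_le_add (hsmul _ _) (hsmul _ _))).trans_lt hz

end Sections

/-! ### Equicontinuity and local convexity in stereotype spaces -/

section StereotypeSeminorms

variable {X : Type*} [AddCommGroup X] [Module ℂ X] [UniformSpace X] [IsUniformAddGroup X]
  [ContinuousSMul ℂ X]

/-- In a stereotype space every totally bounded set of functionals is equicontinuous. -/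
theorem IsStereotype.exists_seminorm (h : IsStereotype X) {S : Set (StereotypeDual X)}
    (hS : TotallyBounded S) :
    ∃ p : Seminorm ℂ X, Continuous p ∧ ∀ f ∈ S, ∀ x, ‖f x‖ ≤ p x := by
  -- The polar of `S` is the preimage of a basic neighbourhood of zero in `X⋆⋆`, so continuity of `X
  -- → X⋆⋆` suffices.
  have hV : {x : X | ∀ f ∈ S, ‖f x‖ ≤ 1} ∈ 𝓝 (0 : X) := by
    have h0 : stereotypeBidualMap (0 : X) = 0 := by
      ext f
      exact map_zero f
    have h1 : ∀ᶠ φ : StereotypeDual (StereotypeDual X) in 𝓝 0,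
        Set.MapsTo φ S (Metric.closedBall 0 1) :=
      UniformConvergenceCLM.eventually_nhds_zero_mapsTo (RingHom.id ℂ) hS
        (Metric.closedBall_mem_nhds _ one_pos)
    have h2 := h.continuous.continuousAt (x := 0)
    rw [ContinuousAt, h0] at h2
    filter_upwards [h2.eventually h1] with x hx f hf
    simpa using! hx hf
  -- The polar absorbs `x`: some nonzero multiple `c • x` lies in it, so `‖c‖⁻¹` is a bound.
  have hb : ∀ x, BddAbove (Set.range fun f : S => ‖f.1 x‖) := by
    intro x
    have hx : ∀ᶠ c : ℂ in 𝓝[≠] 0, c • x ∈ {x : X | ∀ f ∈ S, ‖f x‖ ≤ 1} := by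
      have : Tendsto (fun c : ℂ => c • x) (𝓝 0) (𝓝 0) := by
        have : Continuous fun c : ℂ => c • x := by fun_prop
        simpa using this.tendsto 0
      exact (this.eventually hV).filter_mono nhdsWithin_le_nhds
    obtain ⟨c, hc, hc0⟩ := (hx.and self_mem_nhdsWithin).exists
    refine ⟨‖c‖⁻¹, ?_⟩
    rintro _ ⟨f, rfl⟩
    have := hc f.1 f.2
    rw [map_smul, norm_smul] at this
    have hc0 : 0 < ‖c‖ := norm_pos_iff.2 hc0
    rw [← one_div, le_div_iff₀ hc0, mul_comm]
    exact this
  let p : Seminorm ℂ X := Seminorm.of (fun x => ⨆ f : S, ‖f.1 x‖)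
    (fun x y => Real.iSup_le (fun f => by
        rw [map_add]
        exact (norm_add_le _ _).trans (add_le_add (le_ciSup (hb x) f) (le_ciSup (hb y) f)))
      (add_nonneg (Real.iSup_nonneg fun _ => norm_nonneg _)
        (Real.iSup_nonneg fun _ => norm_nonneg _)))
    (fun c x => by
      rw [Real.mul_iSup_of_nonneg (norm_nonneg c)]
      exact iSup_congr fun f => by rw [map_smul, norm_smul])
  refine ⟨p, Seminorm.continuous' (r := 1) (mem_of_superset hV fun x hx => ?_),
    fun f hf x => le_ciSup (hb x) ⟨f, hf⟩⟩
  rw [Seminorm.mem_closedBall_zero]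
  exact Real.iSup_le (fun f => hx f.1 f.2) zero_le_one

/-- The topology of a stereotype space is generated by its continuous seminorms. -/
theorem IsStereotype.exists_seminorm_lt_one (h : IsStereotype X) {U : Set X}
    (hU : U ∈ 𝓝 (0 : X)) : ∃ p : Seminorm ℂ X, Continuous p ∧ ∀ x, p x < 1 → x ∈ U := by
  have h0 : stereotypeBidualMap (0 : X) = 0 := by
    ext f
    exact map_zero f
  -- Here openness of `X → X⋆⋆` is used: the image of `U` contains all functionals that are small on
  -- some totally bounded `S`, and injectivity brings the conclusion back to `U`.
  have hU' : stereotypeBidualMap '' U ∈ 𝓝 (0 : StereotypeDual (StereotypeDual X)) := by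
    rw [← h0, ← h.isOpenEmbedding.map_nhds_eq]
    exact image_mem_map hU
  obtain ⟨⟨S, ε⟩, ⟨hS, hε⟩, hSU⟩ := (UniformConvergenceCLM.hasBasis_nhds_zero_of_basis
    (RingHom.id ℂ) ℂ {S : Set (StereotypeDual X) | TotallyBounded S} ⟨∅, totallyBounded_empty⟩
    (fun S hS T hT => ⟨S ∪ T, hS.union hT, Set.subset_union_left, Set.subset_union_right⟩)
    Metric.nhds_basis_ball).mem_iff.1 hU'
  obtain ⟨p, hp, hpS⟩ := h.exists_seminorm hS
  have hε : 0 < ε := hε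
  refine ⟨NNReal.mk ε⁻¹ (inv_pos.2 hε).le • p, ?_, fun x hx => ?_⟩
  · exact continuous_const.mul hp
  · have hx : ε⁻¹ * p x < 1 := hx
    have hx : p x < ε := by rwa [inv_mul_lt_iff₀ hε, mul_one] at hx
    obtain ⟨y, hy, hyx⟩ := hSU (a := stereotypeBidualMap x) fun f hf => by
      rw [mem_ball_zero_iff]
      exact (hpS f hf x).trans_lt hx
    rwa [← h.injective hyx]

end StereotypeSeminorms

/-! ### Jets: moving the ideals `I_t`, semicontinuity, density and separation -/

section JetBundle

theorem quotientSeminorm_mk_le {X : Type*} [AddCommGroup X] [Module ℂ X] (p : Seminorm ℂ X)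
    {N : Submodule ℂ X} (x : X) {y : X} (hy : y ∈ N) :
    quotientSeminorm p N (N.mkQ x) ≤ p (x + y) := by
  rw [quotientSeminorm_mk]
  refine ciInf_le ⟨0, ?_⟩ (⟨y, hy⟩ : N)
  rintro _ ⟨y, rfl⟩
  exact apply_nonneg p _

theorem exists_lt_of_quotientSeminorm_lt {X : Type*} [AddCommGroup X] [Module ℂ X]
    {p : Seminorm ℂ X} {N : Submodule ℂ X} {x : X} {r : ℝ}
    (h : quotientSeminorm p N (N.mkQ x) < r) : ∃ y ∈ N, p (x + y) < r := by
  rw [quotientSeminorm_mk] at h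
  obtain ⟨y, hy⟩ := exists_lt_of_ciInf_lt h
  exact ⟨y, y.2, hy⟩

theorem quotientSeminorm_mono {X : Type*} [AddCommGroup X] [Module ℂ X] {p q : Seminorm ℂ X}
    (h : p ≤ q) (N : Submodule ℂ X) : quotientSeminorm p N ≤ quotientSeminorm q N := by
  intro v
  obtain ⟨x, rfl⟩ := N.mkQ_surjective v
  refine le_of_forall_gt fun r hr => ?_
  obtain ⟨y, hy, hxy⟩ := exists_lt_of_quotientSeminorm_lt hr
  exact ((quotientSeminorm_mk_le p x hy).trans (h _)).trans_lt hxy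

section Completion

variable {E : Type*} [AddCommGroup E] [Module ℂ E] [UniformSpace E] [IsUniformAddGroup E]
  [UniformContinuousConstSMul ℂ E]

theorem completionSeminorm_coe (p : Seminorm ℂ E) (hp : Continuous p) (x : E) :
    completionSeminorm p hp x = p x :=
  UniformSpace.Completion.extension_coe (p.uniformContinuous_aux hp) x

theorem continuous_completionSeminorm (p : Seminorm ℂ E) (hp : Continuous p) :
    Continuous (completionSeminorm p hp) :=
  UniformSpace.Completion.continuous_extension

theorem completionSeminorm_mono {p q : Seminorm ℂ E} (hp : Continuous p) (hq : Continuous q)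
    (h : p ≤ q) : completionSeminorm p hp ≤ completionSeminorm q hq := by
  intro v
  refine UniformSpace.Completion.induction_on v (isClosed_le (continuous_completionSeminorm p hp)
    (continuous_completionSeminorm q hq)) fun x => ?_
  rw [completionSeminorm_coe, completionSeminorm_coe]
  exact h x

end Completion

variable {A : Type*} [Ring A] [Algebra ℂ A] [UniformSpace A] [IsUniformAddGroup A]
  [ContinuousSMul ℂ A] [StarRing A]
variable {X : Type*} [AddCommGroup X] [Module ℂ X] [Module A X] [UniformSpace X]
  [IsUniformAddGroup X] [ContinuousSMul ℂ X]

/-- A compact set of characters is totally bounded in `A⋆`, hence equicontinuous. -/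
theorem IsStereotype.exists_seminorm_spectrum (hA : IsStereotype A)
    (T : Compacts (InvolutiveSpectrum A)) :
    ∃ p : Seminorm ℂ A, Continuous p ∧ ∀ t ∈ T, ∀ a, ‖spectrumHom A a t‖ ≤ p a := by
  have hT : IsCompact ((fun t : InvolutiveSpectrum A => t.1) '' (T : Set (InvolutiveSpectrum A))) :=
    T.isCompact.image continuous_subtype_val
  obtain ⟨p, hp, hpT⟩ := hA.exists_seminorm hT.totallyBounded
  exact ⟨p, hp, fun t ht => hpT t.1 ⟨t, ht, rfl⟩⟩

theorem IsStereotypeModule.continuous_const_smul (hX : IsStereotypeModule A X) (a : A) :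
    Continuous fun x : X => a • x := by
  refine continuous_of_continuousAt_zero (DistribSMul.toAddMonoidHom X a) ?_
  intro U hU
  have hU : U ∈ 𝓝 (0 : X) := by simpa using hU
  obtain ⟨V, hV, hVU⟩ := hX.smul.1 {a} (Set.finite_singleton a).totallyBounded U hU
  exact mem_map.2 (mem_of_superset hV fun x hx => hVU a rfl x hx)

/-- The projection onto `I_t` along the unit. It depends continuously on `t` and fixes the elements
of `I_t`, which is how elements of one ideal are carried to the others. -/
theorem InvolutiveSpectrum.sub_mem_ideal (t : InvolutiveSpectrum A) (a : A) :
    a - t.1 a • (1 : A) ∈ t.ideal := by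
  show t.1 (a - t.1 a • (1 : A)) = 0
  rw [map_sub, map_smul, t.2.1]
  simp

/-- Elements of a power of the ideal `I_t₀` extend to families of elements of the same powers of
the ideals `I_t` which act continuously on continuous families of vectors. -/
theorem IsStereotypeModule.exists_ideal_pow_family [IsScalarTower ℂ A X]
    (hX : IsStereotypeModule A X) (t₀ : InvolutiveSpectrum A) {m : ℕ} {a : A}
    (ha : a ∈ t₀.ideal ^ m) :
    ∃ g : InvolutiveSpectrum A → A, g t₀ = a ∧ (∀ t, g t ∈ t.ideal ^ m) ∧
      ∀ f : InvolutiveSpectrum A → X, Continuous f → Continuous fun t => g t • f t := by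
  refine Submodule.pow_induction_on_left' t₀.ideal (C := fun m a _ =>
    ∃ g : InvolutiveSpectrum A → A, g t₀ = a ∧ (∀ t, g t ∈ t.ideal ^ m) ∧
      ∀ f : InvolutiveSpectrum A → X, Continuous f → Continuous fun t => g t • f t)
    (fun c => ?_) ?_ ?_ ha
  · refine ⟨fun _ => algebraMap ℂ A c, rfl, fun t => ?_, fun f hf => ?_⟩
    · rw [pow_zero]
      exact Submodule.algebraMap_mem c
    · exact (hf.const_smul c).congr fun t => (algebraMap_smul A c (f t)).symm
  · rintro _ _ i - - ⟨g, rfl, hg, hgf⟩ ⟨g', rfl, hg', hgf'⟩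
    refine ⟨fun t => g t + g' t, rfl, fun t => add_mem (hg t) (hg' t), fun f hf => ?_⟩
    exact ((hgf f hf).add (hgf' f hf)).congr fun t => (add_smul (g t) (g' t) (f t)).symm
  · rintro b hb i _ - ⟨g, rfl, hg, hgf⟩
    -- The new factor equals `b` at `t₀` because `b ∈ I_t₀`. It acts as `b` minus the scalar `t(b)`,
    -- so only continuity of the action of the fixed element `b` and of `t ↦ t(b)` is needed.
    refine ⟨fun t => (b - t.1 b • (1 : A)) * g t, ?_, fun t => ?_, fun f hf => ?_⟩
    · show (b - t₀.1 b • (1 : A)) * g t₀ = b * g t₀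
      rw [show t₀.1 b = 0 from hb, zero_smul, sub_zero]
    · rw [Nat.succ_eq_add_one, pow_succ']
      exact Submodule.mul_mem_mul (t.sub_mem_ideal b) (hg t)
    · have h1 := (hX.continuous_const_smul b).comp (hgf f hf)
      have h2 := (spectrumHom A b).continuous.smul (hgf f hf)
      refine (h1.sub h2).congr fun t => ?_
      show b • g t • f t - t.1 b • g t • f t = _
      rw [mul_smul, sub_smul, smul_assoc, one_smul]

/-- Elements of `I_t₀^{n+1}·X` extend to continuous families of elements of `I_t^{n+1}·X`. -/
theorem IsStereotypeModule.exists_continuous_family [IsScalarTower ℂ A X]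
    (hX : IsStereotypeModule A X) (n : ℕ) (t₀ : InvolutiveSpectrum A) {y : X}
    (hy : y ∈ Submodule.span ℂ {y | ∃ a ∈ t₀.ideal ^ (n + 1), ∃ x : X, a • x = y}) :
    ∃ f : InvolutiveSpectrum A → X, Continuous f ∧ f t₀ = y ∧ ∀ t, f t ∈ jetSubmodule X n t := by
  induction hy using Submodule.span_induction with
  | mem y hy =>
    obtain ⟨a, ha, x, rfl⟩ := hy
    obtain ⟨g, rfl, hg, hgf⟩ := hX.exists_ideal_pow_family t₀ ha
    exact ⟨fun t => g t • x, hgf _ continuous_const, rfl, fun t =>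
      Submodule.le_topologicalClosure _ (Submodule.subset_span ⟨g t, hg t, x, rfl⟩)⟩
  | zero => exact ⟨0, continuous_const, rfl, fun t => zero_mem _⟩
  | add y z _ _ hy hz =>
    obtain ⟨f, hf, rfl, hfN⟩ := hy
    obtain ⟨g, hg, rfl, hgN⟩ := hz
    exact ⟨f + g, hf.add hg, rfl, fun t => add_mem (hfN t) (hgN t)⟩
  | smul c y _ hy =>
    obtain ⟨f, hf, rfl, hfN⟩ := hy
    exact ⟨c • f, hf.const_smul c, rfl, fun t => Submodule.smul_mem _ c (hfN t)⟩

theorem jetSeminorm_jet (n : ℕ) (p : {p : Seminorm ℂ X // Continuous p})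
    (t : InvolutiveSpectrum A) (x : X) :
    jetSeminorm X n p t (jet n x t) =
      quotientSeminorm p.1 (jetSubmodule X n t) ((jetSubmodule X n t).mkQ x) :=
  completionSeminorm_coe _ (continuous_quotientSeminorm p.1 p.2 _) _

theorem jetSeminorm_jet_le (n : ℕ) (p : {p : Seminorm ℂ X // Continuous p})
    (t : InvolutiveSpectrum A) (x : X) : jetSeminorm X n p t (jet n x t) ≤ p.1 x := by
  rw [jetSeminorm_jet]
  simpa using quotientSeminorm_mk_le p.1 x (zero_mem (jetSubmodule X n t))

theorem jetSeminorm_mono (n : ℕ) {p q : {p : Seminorm ℂ X // Continuous p}} (h : p.1 ≤ q.1)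
    (t : InvolutiveSpectrum A) (v : Jet X n t) :
    jetSeminorm X n p t v ≤ jetSeminorm X n q t v :=
  completionSeminorm_mono (continuous_quotientSeminorm p.1 p.2 _)
    (continuous_quotientSeminorm q.1 q.2 _) (quotientSeminorm_mono h _) v.1

theorem IsStereotypeModule.upperSemicontinuous_jetSeminorm [IsScalarTower ℂ A X]
    (hX : IsStereotypeModule A X) (n : ℕ) (p : {p : Seminorm ℂ X // Continuous p}) (x : X) :
    UpperSemicontinuous fun t : InvolutiveSpectrum A => jetSeminorm X n p t (jet n x t) := by
  intro t₀ r hr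
  obtain ⟨y, hy, hxy⟩ :=
    exists_lt_of_quotientSeminorm_lt ((jetSeminorm_jet n p t₀ x).symm.trans_lt hr)
  -- The infimum runs over the closure, whereas only elements of the span extend to families. As the
  -- inequality is open, `y` can be replaced by such an element `z`.
  have hO : IsOpen {y | p.1 (x + y) < r} :=
    isOpen_lt (p.2.comp (continuous_const.add continuous_id)) continuous_const
  obtain ⟨z, hxz, hz⟩ := mem_closure_iff.1 hy _ hO hxy
  obtain ⟨f, hf, rfl, hfN⟩ := hX.exists_continuous_family n t₀ hz
  filter_upwards [(hO.preimage hf).mem_nhds hxz] with t ht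
  exact ((jetSeminorm_jet n p t x).trans_le (quotientSeminorm_mk_le p.1 x (hfN t))).trans_lt ht

/-- Only the density of the quotient in its completion matters: the pseudocompletion enters as a
subspace of it. -/
theorem exists_jetSeminorm_sub_jet_lt (n : ℕ) (p : {p : Seminorm ℂ X // Continuous p})
    (t : InvolutiveSpectrum A) (v : Jet X n t) {ε : ℝ} (hε : 0 < ε) :
    ∃ x : X, jetSeminorm X n p t (v - jet n x t) < ε := by
  have hc := continuous_completionSeminorm _
    (continuous_quotientSeminorm p.1 p.2 (jetSubmodule X n t))
  obtain ⟨q, hq⟩ := UniformSpace.Completion.denseRange_coe.exists_mem_open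
    (isOpen_lt (hc.comp ((continuous_const (y := v.1)).sub continuous_id))
      (continuous_const (y := ε)))
    ⟨v.1, by simpa using hε⟩
  obtain ⟨x, rfl⟩ := (jetSubmodule X n t).mkQ_surjective q
  exact ⟨x, hq⟩

/-- If `v ≠ 0`, some closed neighbourhood `K` of zero in the completion misses `v`. A continuous
seminorm `p` on `X` whose open unit ball maps into `K` cannot vanish at `v`, since by density the
extended open unit ball lies in the closure of `K`. -/
theorem eq_zero_of_jetSeminorm_eq_zero (hX : IsStereotype X) (n : ℕ) (t : InvolutiveSpectrum A)
    (v : Jet X n t) (hv : ∀ p : {p : Seminorm ℂ X // Continuous p}, jetSeminorm X n p t v = 0) :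
    v = 0 := by
  refine Subtype.ext ?_
  by_contra h0
  have h0 : v.1 ≠ 0 := h0
  obtain ⟨K, ⟨hK, hKc⟩, hKv⟩ := (closed_nhds_basis
    (0 : UniformSpace.Completion (X ⧸ jetSubmodule X n t))).mem_iff.1
      (isOpen_compl_singleton.mem_nhds h0.symm)
  have hcont : Continuous fun x : X =>
      (((jetSubmodule X n t).mkQ x : X ⧸ jetSubmodule X n t) :
        UniformSpace.Completion (X ⧸ jetSubmodule X n t)) :=
    (UniformSpace.Completion.continuous_coe _).comp
      (Submodule.isQuotientMap_mkQ (jetSubmodule X n t)).continuous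
  obtain ⟨p, hp, hpK⟩ := hX.exists_seminorm_lt_one (hcont.continuousAt (x := 0)
    (by simpa only [map_zero, UniformSpace.Completion.coe_zero] using hK))
  have hO := isOpen_lt (continuous_completionSeminorm _
    (continuous_quotientSeminorm p hp (jetSubmodule X n t))) (continuous_const (y := (1 : ℝ)))
  have hvK : v.1 ∈ closure K := by
    refine closure_mono ?_ (UniformSpace.Completion.denseRange_coe.open_subset_closure_inter hO
      ((hv ⟨p, hp⟩).trans_lt one_pos))
    rintro _ ⟨hq, q, rfl⟩
    obtain ⟨x, rfl⟩ := (jetSubmodule X n t).mkQ_surjective q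
    rw [Set.mem_ofPred_eq, completionSeminorm_coe] at hq
    -- The representative `x` itself may have large `p`; `x + y` has the same class and lies in the
    -- unit ball.
    obtain ⟨y, hy, hxy⟩ := exists_lt_of_quotientSeminorm_lt hq
    have := hpK _ hxy
    rwa [Set.mem_preimage, map_add, show (jetSubmodule X n t).mkQ y = 0 from
      (Submodule.Quotient.mk_eq_zero _).2 hy, add_zero] at this
  rw [hKc.closure_eq] at hvK
  exact hKv hvK rfl

/-- The jet map as a linear map to families of jets. -/
def jetLinearMap (A X : Type*) [Ring A] [Algebra ℂ A] [UniformSpace A] [IsUniformAddGroup A]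
    [ContinuousSMul ℂ A] [StarRing A] [AddCommGroup X] [Module ℂ X] [Module A X]
    [UniformSpace X] [IsUniformAddGroup X] [ContinuousSMul ℂ X] (n : ℕ) :
    X →ₗ[ℂ] ∀ t : InvolutiveSpectrum A, Jet X n t where
  toFun x t := jet n x t
  map_add' x y := funext fun t =>
    map_add ((toPseudocompletion _).comp (jetSubmodule X n t).mkQ) x y
  map_smul' c x := funext fun t =>
    map_smul ((toPseudocompletion _).comp (jetSubmodule X n t).mkQ) c x

theorem IsStereotypeModule.isGeneratingFamily [IsScalarTower ℂ A X]
    (hX : IsStereotypeModule A X) (n : ℕ) :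
    IsGeneratingFamily (fun (p : {p : Seminorm ℂ X // Continuous p}) (t : InvolutiveSpectrum A) =>
      jetSeminorm X n p t) (jetLinearMap A X n) where
  nonempty := ⟨⟨0, continuous_const⟩⟩
  directed p q := ⟨⟨p.1 ⊔ q.1, p.2.sup q.2⟩, fun t v =>
    ⟨jetSeminorm_mono n le_sup_left t v, jetSeminorm_mono n le_sup_right t v⟩⟩
  separating := eq_zero_of_jetSeminorm_eq_zero hX.stereotype n
  upperSemicontinuous := hX.upperSemicontinuous_jetSeminorm n
  dense p t v _ hε := exists_jetSeminorm_sub_jet_lt n p t v hε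

end JetBundle

end

theorem mainTheorem7
    {A : Type*} [Ring A] [Algebra ℂ A] [UniformSpace A] [IsUniformAddGroup A]
    [ContinuousSMul ℂ A] [StarRing A] [StarModule ℂ A] [ContinuousStar A]
    (hA : IsStereotypeAlgebra A)
    {X : Type*} [AddCommGroup X] [Module ℂ X] [Module A X] [IsScalarTower ℂ A X]
    [UniformSpace X] [IsUniformAddGroup X] [ContinuousSMul ℂ X]
    (hX : IsStereotypeModule A X) (n : ℕ) :
    ∃ τ : TopologicalSpace (Σ t : InvolutiveSpectrum A, Jet X n t),
      ∃ h : IsLocallyConvexBundle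
          (fun (p : {p : Seminorm ℂ X // Continuous p}) (t : InvolutiveSpectrum A) =>
            jetSeminorm X n p t) τ,
      ∃ hj : ∀ x : X, (fun t : InvolutiveSpectrum A => jet n x t) ∈ h.Sec,
        Continuous (fun x : X => (⟨fun t => jet n x t, hj x⟩ : h.Sec)) ∧
        Continuous (fun z : A × h.Sec => spectrumHom A z.1 • z.2) ∧
        @TopologicalSpace.IsTopologicalBasis _ τ
          {W | ∃ (x : X) (U : Set (InvolutiveSpectrum A))
            (p : {p : Seminorm ℂ X // Continuous p}) (ε : ℝ),
            IsOpen U ∧ 0 < ε ∧ W = jetBasicSet n x U p ε} ∧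
        ∀ τ' : TopologicalSpace (Σ t : InvolutiveSpectrum A, Jet X n t),
          IsLocallyConvexBundle
            (fun (p : {p : Seminorm ℂ X // Continuous p}) (t : InvolutiveSpectrum A) =>
              jetSeminorm X n p t) τ' →
          (∀ x : X, Continuous[_, τ'] fun t : InvolutiveSpectrum A =>
            (⟨t, jet n x t⟩ : Σ t : InvolutiveSpectrum A, Jet X n t)) →
          τ' = τ := by
  have hj := hX.isGeneratingFamily n
  have h := hj.isLocallyConvexBundle
  refine ⟨_, h, hj.continuous_section, ?_, ?_, hj.isTopologicalBasis,
    fun τ' h' hs => hj.eq_generateFrom h' hs⟩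
  · exact h.continuous_of_le
      ((jetLinearMap A X n).codRestrict h.Sec hj.continuous_section)
      (fun p => p.1) (fun p => p.2) fun p x t => jetSeminorm_jet_le n p t x
  · exact h.continuous_smul_sec (spectrumHom A).toLinearMap
      hA.stereotype.exists_seminorm_spectrum
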